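/- Let $G$ be a real, connected, compact, semisimple Lie group (finite-dimensional, Hausdorff, without boundary; semisimple means that its Lie algebra is semisimple). Let $\mathcal{X}$ be a linear vector field on $G$, i.e. a smooth vector field whose flow $(\varphi_t)_{t\in\mathbb{R}}$ consists of Lie group automorphisms of $G$. Then every periodic orbit of $\varphi_t$ is stable. That is, let $\Gamma=\{\varphi_t(g): t\in\mathbb{R}\}$, where $g\in G$ and $\varphi_{t+T}(g)=\varphi_t(g)$ for all $t\in\mathbb{R}$, for some $T>0$ (fixed points are allowed). Then for every open set $V\supseteq\Gamma$ there is an open set $W$ with $\Gamma\subseteq W\subseteq V$ such that every solution $\gamma:\mathbb{R}\to G$ of $\dot\gamma=\mathcal{X}(\gamma)$ with $\gamma(0)\in W$ satisfies $\gamma(t)\in V$ for all $t\ge 0$. -/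

import Mathlib

open Set
open scoped Manifold ContDiff

namespace LinearFlow

section

variable {E : Type*} [NormedAddCommGroup E] [NormedSpace ℝ E]
  {H : Type*} [TopologicalSpace H] (I : ModelWithCorners ℝ E H)
  {G : Type*} [TopologicalSpace G] [ChartedSpace H G]

/-- A smooth real Lie group is of the class `C^3` for which the Lie algebra structure on
`GroupLieAlgebra I G` is set up. -/
instance lieGroup_minSmoothness [Group G] [LieGroup I ∞ G] :
    LieGroup I (minSmoothness ℝ 3) G :=
  LieGroup.of_le (n := ∞) (by
    rw [minSmoothness_of_isRCLikeNormedField]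
    exact ENat.LEInfty.out)

/-- `φ` is the (global) flow of the vector field `X`: for every `g`, the curve `t ↦ φ t g` is the
solution of `ġ = X(g)` with value `g` at time `0`. -/
def IsFlow (X : (g : G) → TangentSpace I g) (φ : ℝ → G → G) : Prop :=
  ∀ g : G, φ 0 g = g ∧ IsMIntegralCurve (I := I) (fun t => φ t g) X

/-- `f` is an automorphism of the Lie group `G`: a group automorphism that is smooth together with
its inverse. -/
def IsLieGroupAutomorphism [Group G] (f : G → G) : Prop :=
  ∃ e : G ≃* G, (∀ g, e g = f g) ∧ ContMDiff I I ∞ e ∧ ContMDiff I I ∞ e.symm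

/-- A linear vector field on a Lie group: a smooth vector field whose flow `(φ t)`, `t ∈ ℝ`,
consists of automorphisms of the Lie group. -/
structure IsLinearVectorField [Group G] [LieGroup I ∞ G] (X : (g : G) → TangentSpace I g) :
    Prop where
  contMDiff : ContMDiff I I.tangent ∞ (fun g : G => (⟨g, X g⟩ : TangentBundle I G))
  exists_flow : ∃ φ : ℝ → G → G, IsFlow I X φ ∧ ∀ t, IsLieGroupAutomorphism I (φ t)

/-- A set `Γ` is stable for `ġ = X(g)`: every open `V ⊇ Γ` contains an open `W ⊇ Γ` such that each
solution starting in `W` at time `0` stays in `V` for all `t ≥ 0`. -/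
def IsStableOrbit (X : (g : G) → TangentSpace I g) (Γ : Set G) : Prop :=
  ∀ V : Set G, IsOpen V → Γ ⊆ V → ∃ W : Set G, IsOpen W ∧ Γ ⊆ W ∧ W ⊆ V ∧
    ∀ γ : ℝ → G, IsMIntegralCurve (I := I) γ X → γ 0 ∈ W → ∀ t : ℝ, 0 ≤ t → γ t ∈ V

end

/-- `Γ` is a periodic orbit of the flow `φ`: the orbit of a point `g` for which `t ↦ φ t g` has a
period `T > 0`. (Fixed points, which have every period, are included.) -/
def IsPeriodicOrbit {G : Type*} (φ : ℝ → G → G) (Γ : Set G) : Prop :=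
  ∃ g : G, (∃ T : ℝ, 0 < T ∧ ∀ t : ℝ, φ (t + T) g = φ t g) ∧ Γ = range (fun t => φ t g)

end LinearFlow

/-!
The character `χ(g) = tr (Ad g)` of the adjoint representation is continuous and invariant under
Lie group automorphisms, so it is constant along the flow of a linear vector field. On a compact
group `Ad` preserves an inner product, so `χ(g) ≤ dim G` with equality only if `Ad g = 1`. The
derivative of `Ad` at `1` is `ad`, which is injective when the centre of the Lie algebra is trivial;
hence `Ad g ≠ 1` for `g ≠ 1` near `1`, and `1` is a strict local maximum of the first integral `χ`.
So the fixed point `1` is Lyapunov stable, and since `φ_t(x w) = φ_t(x) φ_t(w)`, its stability is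
transported to every compact invariant set.
-/

namespace LinearFlow

open Filter Topology

section Topology

theorem eventually_forall_isPreconnected_subset {X α : Type*} [TopologicalSpace X] [R1Space X]
    [WeaklyLocallyCompactSpace X] [TopologicalSpace α] [LinearOrder α] [OrderClosedTopology α]
    {f : X → α} (hf : Continuous f) {p : X} (hp : ∀ᶠ x in 𝓝[≠] p, f x < f p)
    {U : Set X} (hU : U ∈ 𝓝 p) :
    ∀ᶠ x in 𝓝 p, ∀ S, IsPreconnected S → x ∈ S → (∀ y ∈ S, f x ≤ f y) → S ⊆ U := by
  obtain ⟨K, ⟨hKp, hKcomp, hKclosed⟩, hKU⟩ :=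
    (isCompact_isClosed_basis_nhds p).mem_iff.1 (inter_mem hU (eventually_nhdsWithin_iff.1 hp))
  have hfrontier : ∀ y ∈ frontier K, f y < f p := fun y hy =>
    (hKU (hKclosed.frontier_subset hy)).2 <| by
      rintro rfl
      exact hy.2 (mem_interior_iff_mem_nhds.2 hKp)
  have hbarrier : ∀ᶠ x in 𝓝 p, ∀ y ∈ frontier K, f y < f x :=
    (hKcomp.of_isClosed_subset isClosed_frontier
      hKclosed.frontier_subset).eventually_forall_of_forall_eventually fun y hy =>
        (isOpen_lt (hf.comp continuous_snd) (hf.comp continuous_fst)).mem_nhds (hfrontier y hy)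
  filter_upwards [hbarrier, interior_mem_nhds.2 hKp] with x hx hxK S hS hxS hfS
  have hcover : S ⊆ interior K ∪ Kᶜ := fun y hy => by
    by_contra! h
    simp only [mem_union, mem_compl_iff, not_or, not_not] at h
    exact (hfS y hy).not_gt (hx y ⟨subset_closure h.2, h.1⟩)
  have hSK : S ⊆ interior K :=
    hS.subset_left_of_subset_union isOpen_interior hKclosed.isOpen_compl
      (disjoint_compl_right.mono_left interior_subset) hcover ⟨x, hxS, hxK⟩
  exact fun y hy => (hKU (interior_subset (hSK hy))).1

open scoped Pointwise in
theorem eventually_nhdsSet_forall_map_mem {ι G G' : Type*} [Group G] [TopologicalSpace G]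
    [IsTopologicalGroup G] [Group G'] [TopologicalSpace G'] [IsTopologicalGroup G']
    {φ : ι → G →* G'} (h1 : ∀ U ∈ 𝓝 (1 : G'), ∀ᶠ x in 𝓝 1, ∀ i, φ i x ∈ U)
    {K : Set G} {L V : Set G'} (hL : IsCompact L) (hφ : ∀ i, MapsTo (φ i) K L) (hV : V ∈ 𝓝ˢ L) :
    ∀ᶠ x in 𝓝ˢ K, ∀ i, φ i x ∈ V := by
  obtain ⟨V', hV', hLV', hV'V⟩ := mem_nhdsSet_iff_exists.1 hV
  obtain ⟨U, hU, hUV⟩ := compact_open_separated_mul_right hL hV' hLV'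
  obtain ⟨W, hWU, hW, h1W⟩ := eventually_nhds_iff.1 (h1 U hU)
  refine mem_of_superset (hW.mul_left.mem_nhdsSet.2 (subset_mul_left K h1W)) ?_
  rintro _ ⟨k, hk, w, hw, rfl⟩ i
  rw [map_mul]
  exact hV'V (hUV (mul_mem_mul (hφ i hk) (hWU w hw i)))

end Topology

section UnitaryTrick

open Module

theorem trace_lt_finrank_of_norm_map_le {F : Type*} [NormedAddCommGroup F]
    [InnerProductSpace ℝ F] [FiniteDimensional ℝ F] {M : F →ₗ[ℝ] F} (hM : ∀ v, ‖M v‖ ≤ ‖v‖)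
    (hne : M ≠ LinearMap.id) : LinearMap.trace ℝ F M < finrank ℝ F := by
  let b := stdOrthonormalBasis ℝ F
  have hdist : ∀ i, ‖b i - M (b i)‖ ^ 2 ≤ 2 * (1 - inner ℝ (b i) (M (b i))) := fun i => by
    have hle : ‖M (b i)‖ ^ 2 ≤ 1 :=
      pow_le_one₀ (norm_nonneg _) ((hM (b i)).trans_eq (b.norm_eq_one i))
    rw [norm_sub_sq_real, b.norm_eq_one]
    linarith
  have hle : ∀ i, inner ℝ (b i) (M (b i)) ≤ 1 := fun i => by
    linarith [hdist i, sq_nonneg ‖b i - M (b i)‖]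
  obtain ⟨i, hi⟩ : ∃ i, b i ≠ M (b i) := by
    by_contra! h
    exact hne (b.toBasis.ext fun i => by simpa using (h i).symm)
  have hlt : inner ℝ (b i) (M (b i)) < 1 := by
    linarith [hdist i, pow_pos (norm_sub_pos_iff.2 hi) 2]
  calc LinearMap.trace ℝ F M = ∑ i, inner ℝ (b i) (M (b i)) := LinearMap.trace_eq_sum_inner M b
    _ < ∑ _i : Fin (finrank ℝ F), (1 : ℝ) :=
      Finset.sum_lt_sum (fun i _ => hle i) ⟨i, Finset.mem_univ i, hlt⟩
    _ = finrank ℝ F := by simp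

theorem exists_linearEquiv_inner_eq {V : Type*} [AddCommGroup V] [Module ℝ V]
    [FiniteDimensional ℝ V] (c : InnerProductSpace.Core ℝ V) :
    ∃ T : V ≃ₗ[ℝ] EuclideanSpace ℝ (Fin (finrank ℝ V)),
      ∀ u v, inner ℝ (T u) (T v) = c.inner u v := by
  let := c.toNormedAddCommGroup
  let := InnerProductSpace.ofCore c.toCore
  exact ⟨(stdOrthonormalBasis ℝ V).repr.toLinearEquiv, (stdOrthonormalBasis ℝ V).repr.inner_map_map⟩

open MeasureTheory

variable {E : Type*} [NormedAddCommGroup E] [NormedSpace ℝ E] [FiniteDimensional ℝ E]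
  {G : Type*} [TopologicalSpace G] [Group G] [IsTopologicalGroup G] [CompactSpace G]
  {ρ : G →* (E →L[ℝ] E)}

theorem exists_invariant_innerProduct (hρ : Continuous ρ) :
    ∃ c : InnerProductSpace.Core ℝ E, ∀ g u v, c.inner (ρ g u) (ρ g v) = c.inner u v := by
  borelize G
  let F (u v : E) (g : G) : ℝ := inner ℝ (toEuclidean (ρ g⁻¹ u)) (toEuclidean (ρ g⁻¹ v))
  have hcoord (u : E) : Continuous fun g => toEuclidean (ρ g⁻¹ u) :=
    toEuclidean.continuous.comp ((hρ.comp continuous_inv).clm_apply continuous_const)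
  have hF (u v : E) : Continuous (F u v) := (hcoord u).inner (hcoord v)
  have hint (u v : E) : Integrable (F u v) Measure.haar :=
    (hF u v).integrable_of_hasCompactSupport (.of_compactSpace _)
  let c : InnerProductSpace.Core ℝ E :=
    { inner u v := ∫ g, F u v g ∂Measure.haar
      conj_inner_symm u v := integral_congr_ae (.of_forall fun g => real_inner_comm _ _)
      re_inner_nonneg v := integral_nonneg fun g => real_inner_self_nonneg
      add_left u v w := by
        rw [← integral_add (hint u w) (hint v w)]
        simp only [F, map_add, inner_add_left]
      smul_left u v r := by
        rw [← integral_const_mul]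
        simp only [F, map_smul, inner_smul_left]
      definite v hv := by
        by_contra hne
        have hpos : 0 < ∫ g, F v v g ∂Measure.haar :=
          (hF v v).integral_pos_of_hasCompactSupport_nonneg_nonzero (.of_compactSpace _)
            (fun g => real_inner_self_nonneg) (x := 1) (by simpa [F] using hne)
        exact hpos.ne' hv }
  refine ⟨c, fun h u v => ?_⟩
  calc ∫ g, F (ρ h u) (ρ h v) g ∂Measure.haar = ∫ g, F u v (h⁻¹ * g) ∂Measure.haar := by
        simp [F, map_mul]
    _ = ∫ g, F u v g ∂Measure.haar := integral_mul_left_eq_self (F u v) h⁻¹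

theorem trace_lt_finrank_of_ne_one (hρ : Continuous ρ) {g : G} (hg : ρ g ≠ 1) :
    LinearMap.trace ℝ E (ρ g) < finrank ℝ E := by
  obtain ⟨c, hc⟩ := exists_invariant_innerProduct hρ
  obtain ⟨T, hT⟩ := exists_linearEquiv_inner_eq c
  have hnorm (v) : ‖T.conj (ρ g) v‖ = ‖v‖ := by
    rw [norm_eq_sqrt_real_inner, norm_eq_sqrt_real_inner v, LinearEquiv.conj_apply_apply, hT,
      ContinuousLinearMap.coe_coe, hc, ← hT, T.apply_symm_apply]
  have hne : T.conj (ρ g : E →ₗ[ℝ] E) ≠ LinearMap.id := fun h => hg <| by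
    rw [← LinearEquiv.conj_id T] at h
    exact ContinuousLinearMap.coe_injective (T.conj.injective h)
  simpa using trace_lt_finrank_of_norm_map_le (fun v => (hnorm v).le) hne

end UnitaryTrick

section Calculus

variable {𝕜 : Type*} [NontriviallyNormedField 𝕜]
  {E : Type*} [NormedAddCommGroup E] [NormedSpace 𝕜 E]
  {F : Type*} [NormedAddCommGroup F] [NormedSpace 𝕜 F]
  {W : Type*} [NormedAddCommGroup W] [NormedSpace 𝕜 W]

open ContinuousLinearMap

theorem hasFDerivAt_of_eventually_mul_eq {A : Type*} [NormedRing A] [HasSummableGeomSeries A]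
    [NormedAlgebra 𝕜 A] {R L P : E → A} {R' L' : E →L[𝕜] A} {x : E} (hR : HasFDerivAt R R' x)
    (hL : HasFDerivAt L L' x) (hRx : R x = 1) (hLx : L x = 1) (hP : ∀ᶠ y in 𝓝 x, R y * P y = L y) :
    HasFDerivAt P (L' - R') x := by
  have hinv : HasFDerivAt Ring.inverse (-mulLeftRight 𝕜 A 1 1) (R x) := by
    simpa [hRx] using hasFDerivAt_ringInverse (𝕜 := 𝕜) (1 : Aˣ)
  have hprod := (hinv.comp x hR).mul' hL
  have hunit : ∀ᶠ y in 𝓝 x, IsUnit (R y) :=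
    hR.continuousAt.eventually (Units.isOpen.mem_nhds (hRx ▸ isUnit_one))
  refine (hprod.congr_of_eventuallyEq ?_).congr_fderiv ?_
  · filter_upwards [hP, hunit] with y hPy hy
    simp [← hPy, ← mul_assoc, Ring.inverse_mul_cancel _ hy]
  · ext v
    simp [hRx, hLx, sub_eq_add_neg]

variable (𝕜) in
/-- The mixed second derivative `(v, w) ↦ ∂₁∂₂m(v, w)` at `p` of a function `m` of two variables. -/
noncomputable def mixedFDeriv (m : E × F → W) (p : E × F) : E →L[𝕜] F →L[𝕜] W :=
  (precomp W (inr 𝕜 E F)).comp ((fderiv 𝕜 (fderiv 𝕜 m) p).comp (inl 𝕜 E F))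

variable {m : E × F → W} {n : ℕ∞ω} {a : E} {b : F}

theorem hasFDerivAt_fderiv (hm : ContDiffAt 𝕜 n m (a, b)) (hn : 2 ≤ n) :
    HasFDerivAt (fderiv 𝕜 m) (fderiv 𝕜 (fderiv 𝕜 m) (a, b)) (a, b) :=
  ((hm.fderiv_right (m := 1) (one_add_one_eq_two.trans_le hn)).differentiableAt
    one_ne_zero).hasFDerivAt

theorem hasFDerivAt_fderiv_comp_inr (hm : ContDiffAt 𝕜 n m (a, b)) (hn : 2 ≤ n) :
    HasFDerivAt (fun x => (fderiv 𝕜 m (x, b)).comp (inr 𝕜 E F)) (mixedFDeriv 𝕜 m (a, b)) a := by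
  have h := (hasFDerivAt_fderiv hm hn).comp (f := fun x => (x, b)) a (hasFDerivAt_prodMk_left a b)
  exact (precomp W (inr 𝕜 E F)).hasFDerivAt.comp a h

theorem hasFDerivAt_fderiv_comp_inl (hm : ContDiffAt 𝕜 n m (a, b)) (hn : minSmoothness 𝕜 2 ≤ n) :
    HasFDerivAt (fun y => (fderiv 𝕜 m (a, y)).comp (inl 𝕜 E F))
      (mixedFDeriv 𝕜 m (a, b)).flip b := by
  have hsymm := hm.isSymmSndFDerivAt hn
  refine (((precomp W (inl 𝕜 E F)).hasFDerivAt.comp (a, b)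
    (hasFDerivAt_fderiv hm (le_minSmoothness.trans hn))).comp b
      (hasFDerivAt_prodMk_right a b)).congr_fderiv ?_
  ext w v
  exact hsymm (0, w) (v, 0)

end Calculus

section AdjointRepresentation

variable {𝕜 : Type*} [NontriviallyNormedField 𝕜]
  {E : Type*} [NormedAddCommGroup E] [NormedSpace 𝕜 E]
  {H : Type*} [TopologicalSpace H] {I : ModelWithCorners 𝕜 E H}
  {M : Type*} [TopologicalSpace M] [ChartedSpace H M]
  {E' : Type*} [NormedAddCommGroup E'] [NormedSpace 𝕜 E']
  {H' : Type*} [TopologicalSpace H'] {I' : ModelWithCorners 𝕜 E' H'}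
  {M' : Type*} [TopologicalSpace M'] [ChartedSpace H' M']
  {E'' : Type*} [NormedAddCommGroup E''] [NormedSpace 𝕜 E'']
  {H'' : Type*} [TopologicalSpace H''] {I'' : ModelWithCorners 𝕜 E'' H''}
  {M'' : Type*} [TopologicalSpace M''] [ChartedSpace H'' M'']

variable (I I') in
/-- The derivative of `f` at `x` as a map between the model spaces, to which all tangent spaces are
definitionally equal. It allows derivatives at different points to be compared and composed. -/
noncomputable def modelDeriv (f : M → M') (x : M) : E →L[𝕜] E' := mfderiv I I' f x

theorem modelDeriv_comp {f : M → M'} {g : M' → M''} {x : M} {y : M'}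
    (hg : MDifferentiableAt I' I'' g y) (hf : MDifferentiableAt I I' f x) (hy : f x = y) :
    modelDeriv I I'' (g ∘ f) x = (modelDeriv I' I'' g y).comp (modelDeriv I I' f x) := by
  subst hy
  exact mfderiv_comp x hg hf

theorem modelDeriv_id (x : M) : modelDeriv I I id x = 1 := mfderiv_id

theorem modelDeriv_extChartAt_self [IsManifold I 1 M] (x : M) :
    modelDeriv I 𝓘(𝕜, E) (extChartAt I x) x = 1 :=
  mfderiv_extChartAt_self

theorem extChartAt_target_mem_nhds_of_boundarylessManifold [BoundarylessManifold I M] (x : M) :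
    (extChartAt I x).target ∈ 𝓝 (extChartAt I x x) :=
  mem_interior_iff_mem_nhds.1 (I.isInteriorPoint_iff.1 BoundarylessManifold.isInteriorPoint)

theorem contMDiffAt_extChartAt_symm_self [BoundarylessManifold I M] {n : ℕ∞ω} [IsManifold I n M]
    (x : M) : ContMDiffAt 𝓘(𝕜, E) I n (extChartAt I x).symm (extChartAt I x x) :=
  (contMDiffOn_extChartAt_symm x).contMDiffAt (extChartAt_target_mem_nhds_of_boundarylessManifold x)

theorem hasFDerivAt_extChartAt_comp [BoundarylessManifold I M] [IsManifold I 1 M]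
    [IsManifold I' 1 M'] {f : M → M'} {x : M} {z : M'} (hf : MDifferentiableAt I I' f x)
    (hz : f x ∈ (extChartAt I' z).source) :
    HasFDerivAt (fun y => extChartAt I' z (f ((extChartAt I x).symm y)))
      ((modelDeriv I' 𝓘(𝕜, E') (extChartAt I' z) (f x)).comp (modelDeriv I I' f x))
      (extChartAt I x x) := by
  have hsymm : HasMFDerivAt 𝓘(𝕜, E) I (extChartAt I x).symm (extChartAt I x x)
      (ContinuousLinearMap.id 𝕜 E) := by
    have h := ((contMDiffAt_extChartAt_symm_self (n := 1) (I := I) x).mdifferentiableAt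
      one_ne_zero).hasMFDerivAt
    rwa [← mfderivWithin_of_mem_nhds, mfderivWithin_range_extChartAt_symm] at h
    exact range_mem_nhds_isInteriorPoint BoundarylessManifold.isInteriorPoint
  have hchart : MDifferentiableAt I' 𝓘(𝕜, E') (extChartAt I' z) (f x) :=
    mdifferentiableAt_extChartAt (by simpa using hz)
  have hcomp : HasMFDerivAt I 𝓘(𝕜, E') (extChartAt I' z ∘ f) x
      ((modelDeriv I' 𝓘(𝕜, E') (extChartAt I' z) (f x)).comp (modelDeriv I I' f x)) :=
    hchart.hasMFDerivAt.comp x hf.hasMFDerivAt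
  exact (HasMFDerivAt.comp (I' := I) (extChartAt I x x) (g := extChartAt I' z ∘ f)
    (by rwa [extChartAt_to_inv]) hsymm).hasFDerivAt

variable {G : Type*} [TopologicalSpace G] [ChartedSpace H G] [Group G]
  {G' : Type*} [TopologicalSpace G'] [ChartedSpace H' G'] [Group G']

theorem modelDeriv_symm_comp_modelDeriv {e : G ≃* G'} (he : MDifferentiable I I' e)
    (hesymm : MDifferentiable I' I e.symm) :
    (modelDeriv I' I e.symm 1).comp (modelDeriv I I' e 1) = 1 := by
  rw [← modelDeriv_comp (hesymm 1) (he 1) (map_one e), ← modelDeriv_id (I := I) (1 : G)]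
  congr 1
  ext x
  simp

variable [LieGroup I 1 G]

theorem mdifferentiable_conj (g : G) : MDifferentiable I I (MulAut.conj g) :=
  (mdifferentiable_mul_right (a := g⁻¹)).comp (mdifferentiable_mul_left (a := g))

variable (I) in
/-- The adjoint representation of a Lie group on its tangent space at `1`, identified with the
model space. -/
noncomputable def Ad : G →* (E →L[𝕜] E) where
  toFun g := modelDeriv I I (MulAut.conj g) 1
  map_one' := by
    rw [map_one]
    exact modelDeriv_id 1
  map_mul' g h := by
    rw [map_mul]
    exact modelDeriv_comp (mdifferentiable_conj g 1) (mdifferentiable_conj h 1)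
      (map_one (MulAut.conj h))

theorem modelDeriv_mul_left_eq (g : G) :
    modelDeriv I I (g * ·) 1 = (modelDeriv I I (· * g) 1).comp (Ad I g) := by
  simp only [Ad, MonoidHom.coe_mk, OneHom.coe_mk]
  rw [← modelDeriv_comp (mdifferentiable_mul_right 1) (mdifferentiable_conj g 1)
    (map_one (MulAut.conj g))]
  congr 1
  ext x
  simp

variable [LieGroup I' 1 G']

theorem modelDeriv_comp_Ad {f : G →* G'} (hf : MDifferentiable I I' f) (g : G) :
    (modelDeriv I I' f 1).comp (Ad I g) = (Ad I' (f g)).comp (modelDeriv I I' f 1) := by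
  simp only [Ad, MonoidHom.coe_mk, OneHom.coe_mk]
  rw [← modelDeriv_comp (hf 1) (mdifferentiable_conj g 1) (map_one (MulAut.conj g)),
    ← modelDeriv_comp (mdifferentiable_conj (f g) 1) (hf 1) (map_one f)]
  congr 1
  ext x
  simp

variable (I) in
/-- The character `g ↦ tr (Ad g)` of the adjoint representation. -/
noncomputable def adjointCharacter (g : G) : 𝕜 := LinearMap.trace 𝕜 E (Ad I g)

theorem adjointCharacter_one [FiniteDimensional 𝕜 E] :
    adjointCharacter I (1 : G) = Module.finrank 𝕜 E := by
  rw [adjointCharacter, map_one]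
  exact LinearMap.trace_one 𝕜 E

theorem adjointCharacter_map_mulEquiv {e : G ≃* G'} (he : MDifferentiable I I' e)
    (hesymm : MDifferentiable I' I e.symm) (g : G) :
    adjointCharacter I' (e g) = adjointCharacter I g := by
  let T : E ≃ₗ[𝕜] E' := .ofLinearMap (modelDeriv I I' e 1) (modelDeriv I' I e.symm 1)
    (congrArg ContinuousLinearMap.toLinearMap (modelDeriv_symm_comp_modelDeriv hesymm he))
    (congrArg ContinuousLinearMap.toLinearMap (modelDeriv_symm_comp_modelDeriv he hesymm))
  have hconj : (Ad I' (e g) : E' →ₗ[𝕜] E') = T.conj (Ad I g) := by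
    rw [LinearEquiv.conj_apply, LinearEquiv.eq_comp_toLinearMap_symm]
    exact congrArg ContinuousLinearMap.toLinearMap
      (modelDeriv_comp_Ad (f := e.toMonoidHom) he g).symm
  rw [adjointCharacter, adjointCharacter, hconj, LinearMap.trace_conj']

end AdjointRepresentation

section ChartAtOne

variable {𝕜 : Type*} [NontriviallyNormedField 𝕜]
  {E : Type*} [NormedAddCommGroup E] [NormedSpace 𝕜 E]
  {H : Type*} [TopologicalSpace H] {I : ModelWithCorners 𝕜 E H}
  {G : Type*} [TopologicalSpace G] [ChartedSpace H G] [Group G]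

instance lieGroup_one_of_minSmoothness [LieGroup I (minSmoothness 𝕜 3) G] : LieGroup I 1 G :=
  LieGroup.of_le (n := minSmoothness 𝕜 3) (le_trans (by norm_num) le_minSmoothness)

variable (I G) in
/-- The multiplication of `G` read in the chart at `1`. -/
noncomputable def chartMul (p : E × E) : E :=
  extChartAt I (1 : G) ((extChartAt I (1 : G)).symm p.1 * (extChartAt I (1 : G)).symm p.2)

local notation "ψ" => extChartAt I (1 : G)

variable [LieGroup I (minSmoothness 𝕜 3) G] [BoundarylessManifold I G]

theorem contDiffAt_chartMul :
    ContDiffAt 𝕜 (minSmoothness 𝕜 3) (chartMul I G) (ψ 1, ψ 1) := by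
  have hsymm : ContMDiffAt 𝓘(𝕜, E) I (minSmoothness 𝕜 3) (ψ).symm (ψ 1) :=
    contMDiffAt_extChartAt_symm_self 1
  have hcoord (π : E × E →L[𝕜] E) (hπ : π (ψ 1, ψ 1) = ψ 1) :
      ContMDiffAt 𝓘(𝕜, E × E) I (minSmoothness 𝕜 3) ((ψ).symm ∘ π) (ψ 1, ψ 1) :=
    ContMDiffAt.comp_of_eq hsymm π.contDiff.contMDiff.contMDiffAt hπ
  have hmul := (hcoord (.fst 𝕜 E E) rfl).mul (hcoord (.snd 𝕜 E E) rfl)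
  refine contMDiffAt_iff_contDiffAt.1 (ContMDiffAt.comp (I' := I) _ ?_ hmul)
  simp only [extChartAt_to_inv, mul_one]
  exact contMDiffAt_extChartAt

variable (I G) in
/-- The derivative at `1` of the left translation by the point with coordinates `x`, in the chart
at `1`: the second partial derivative of `chartMul` at `(x, ψ 1)`. -/
noncomputable def chartLeftDeriv (x : E) : E →L[𝕜] E :=
  (fderiv 𝕜 (chartMul I G) (x, ψ 1)).comp (.inr 𝕜 E E)

variable (I G) in
/-- The derivative at `1` of the right translation by the point with coordinates `x`, in the chart
at `1`: the first partial derivative of `chartMul` at `(ψ 1, x)`. -/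
noncomputable def chartRightDeriv (x : E) : E →L[𝕜] E :=
  (fderiv 𝕜 (chartMul I G) (ψ 1, x)).comp (.inl 𝕜 E E)

variable (I G) in
/-- The Lie bracket in the chart at `1`: the antisymmetrised second derivative of the
multiplication. -/
noncomputable def chartBracket : E →L[𝕜] E →L[𝕜] E :=
  mixedFDeriv 𝕜 (chartMul I G) (ψ 1, ψ 1) - (mixedFDeriv 𝕜 (chartMul I G) (ψ 1, ψ 1)).flip

theorem eventually_differentiableAt_chartMul :
    ∀ᶠ p in 𝓝 (ψ 1, ψ 1), DifferentiableAt 𝕜 (chartMul I G) p := by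
  have h : ContDiffAt 𝕜 1 (chartMul I G) (ψ 1, ψ 1) :=
    contDiffAt_chartMul.of_le (le_trans (by norm_num) le_minSmoothness)
  filter_upwards [h.eventually (by simp)] with p hp
  exact hp.differentiableAt one_ne_zero

theorem eventually_chartLeftDeriv_eq :
    ∀ᶠ x in 𝓝 (ψ 1), chartLeftDeriv I G x =
      (modelDeriv I 𝓘(𝕜, E) ψ ((ψ).symm x)).comp (modelDeriv I I ((ψ).symm x * ·) 1) := by
  filter_upwards [(Continuous.prodMk_left (ψ 1)).continuousAt.eventually
    (eventually_differentiableAt_chartMul (I := I) (G := G)),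
    extChartAt_target_mem_nhds_of_boundarylessManifold 1] with x hdiff hx
  have hpartial := hdiff.hasFDerivAt.comp (ψ 1) (hasFDerivAt_prodMk_right x (ψ 1))
  have hchart := hasFDerivAt_extChartAt_comp (I := I) (I' := I) (z := (1 : G))
    (mdifferentiable_mul_left (a := (ψ).symm x) 1) (by simpa only [mul_one] using (ψ).map_target hx)
  rw [mul_one] at hchart
  exact hpartial.unique hchart

theorem eventually_chartRightDeriv_eq :
    ∀ᶠ x in 𝓝 (ψ 1), chartRightDeriv I G x =
      (modelDeriv I 𝓘(𝕜, E) ψ ((ψ).symm x)).comp (modelDeriv I I (· * (ψ).symm x) 1) := by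
  filter_upwards [(Continuous.prodMk_right (ψ 1)).continuousAt.eventually
    (eventually_differentiableAt_chartMul (I := I) (G := G)),
    extChartAt_target_mem_nhds_of_boundarylessManifold 1] with x hdiff hx
  have hpartial := hdiff.hasFDerivAt.comp (f := fun y => (y, x)) (ψ 1)
    (hasFDerivAt_prodMk_left (ψ 1) x)
  have hchart := hasFDerivAt_extChartAt_comp (I := I) (I' := I) (z := (1 : G))
    (mdifferentiable_mul_right (a := (ψ).symm x) 1)
    (by simpa only [one_mul] using (ψ).map_target hx)
  rw [one_mul] at hchart
  exact hpartial.unique hchart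

theorem chartLeftDeriv_extChartAt_one : chartLeftDeriv I G (ψ 1) = 1 := by
  rw [(eventually_chartLeftDeriv_eq (I := I) (G := G)).self_of_nhds, extChartAt_to_inv]
  simp only [one_mul]
  rw [modelDeriv_extChartAt_self]
  exact modelDeriv_id 1

theorem chartRightDeriv_extChartAt_one : chartRightDeriv I G (ψ 1) = 1 := by
  rw [(eventually_chartRightDeriv_eq (I := I) (G := G)).self_of_nhds, extChartAt_to_inv]
  simp only [mul_one]
  rw [modelDeriv_extChartAt_self]
  exact modelDeriv_id 1

theorem hasFDerivAt_chartLeftDeriv :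
    HasFDerivAt (chartLeftDeriv I G) (mixedFDeriv 𝕜 (chartMul I G) (ψ 1, ψ 1)) (ψ 1) :=
  hasFDerivAt_fderiv_comp_inr contDiffAt_chartMul (le_trans (by norm_num) le_minSmoothness)

theorem hasFDerivAt_Ad_extChartAt_symm [CompleteSpace E] :
    HasFDerivAt (fun x => Ad I ((ψ).symm x)) (chartBracket I G) (ψ 1) := by
  refine hasFDerivAt_of_eventually_mul_eq
    (hasFDerivAt_fderiv_comp_inl contDiffAt_chartMul (minSmoothness_monotone (by norm_num)))
    hasFDerivAt_chartLeftDeriv chartRightDeriv_extChartAt_one chartLeftDeriv_extChartAt_one ?_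
  -- `g * x = (g * x * g⁻¹) * g` gives `chartLeftDeriv = chartRightDeriv * Ad`.
  filter_upwards [eventually_chartLeftDeriv_eq (I := I) (G := G),
    eventually_chartRightDeriv_eq (I := I) (G := G)] with x hleft hright
  change chartRightDeriv I G x * _ = _
  rw [hleft, hright, modelDeriv_mul_left_eq]
  rfl

theorem eventually_mpullback_mulInvariantVectorField (v : GroupLieAlgebra I G) :
    VectorField.mpullbackWithin 𝓘(𝕜, E) I (ψ).symm (mulInvariantVectorField v) (range I)
      =ᶠ[𝓝 (ψ 1)] fun x => chartLeftDeriv I G x v := by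
  filter_upwards [eventually_chartLeftDeriv_eq (I := I) (G := G),
    extChartAt_target_mem_nhds_of_boundarylessManifold 1] with x hleft hx
  rw [VectorField.mpullbackWithin_apply, ContinuousLinearMap.inverse_eq
    (mfderivWithin_extChartAt_symm_comp_mfderiv_extChartAt (I := I) hx)
    (mfderiv_extChartAt_comp_mfderivWithin_extChartAt_symm (I := I) hx), hleft]
  rfl

theorem lie_eq_chartBracket (v w : GroupLieAlgebra I G) : ⁅v, w⁆ = (chartBracket I G v w : E) := by
  have hderiv (w : E) : HasFDerivAt (fun x => chartLeftDeriv I G x w)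
      ((mixedFDeriv 𝕜 (chartMul I G) (ψ 1, ψ 1)).flip w) (ψ 1) :=
    (ContinuousLinearMap.apply 𝕜 E w).hasFDerivAt.comp _ hasFDerivAt_chartLeftDeriv
  rw [GroupLieAlgebra.bracket_def, ← VectorField.mlieBracketWithin_univ,
    VectorField.mlieBracketWithin_apply, preimage_univ, univ_inter,
    (eventually_mpullback_mulInvariantVectorField v).lieBracketWithin_vectorField_eq_nhds
      (eventually_mpullback_mulInvariantVectorField w),
    VectorField.lieBracketWithin_of_mem_nhds
      (range_mem_nhds_isInteriorPoint BoundarylessManifold.isInteriorPoint),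
    VectorField.lieBracket_eq, mfderiv_extChartAt_self]
  simp only [(hderiv v).fderiv, (hderiv w).fderiv, chartLeftDeriv_extChartAt_one]
  exact DFunLike.congr_fun (ContinuousLinearMap.inverse_id (R := 𝕜) (M := E)) (chartBracket I G v w)

end ChartAtOne

section AdjointTopology

variable {𝕜 : Type*} [NontriviallyNormedField 𝕜]
  {E : Type*} [NormedAddCommGroup E] [NormedSpace 𝕜 E] [CompleteSpace E]
  {H : Type*} [TopologicalSpace H] {I : ModelWithCorners 𝕜 E H}
  {G : Type*} [TopologicalSpace G] [ChartedSpace H G] [Group G]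
  [LieGroup I (minSmoothness 𝕜 3) G] [BoundarylessManifold I G]

theorem continuous_Ad : Continuous (Ad I : G →* (E →L[𝕜] E)) := by
  have : IsTopologicalGroup G := topologicalGroup_of_lieGroup I 1
  refine continuous_of_continuousAt_one _ ?_
  refine (hasFDerivAt_Ad_extChartAt_symm.continuousAt.comp
    (continuousAt_extChartAt (I := I) (1 : G))).congr ?_
  filter_upwards [extChartAt_source_mem_nhds (I := I) (1 : G)] with g hg
  exact congrArg (Ad I) ((extChartAt I (1 : G)).left_inv hg)

theorem eq_zero_of_chartBracket_eq_zero (hZ : LieAlgebra.center 𝕜 (GroupLieAlgebra I G) = ⊥)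
    {v : GroupLieAlgebra I G} (hv : chartBracket I G v = 0) : v = 0 := by
  have hcenter : v ∈ LieAlgebra.center 𝕜 (GroupLieAlgebra I G) :=
    (LieModule.mem_maxTrivSubmodule _ _ _ v).2 fun w => by
      rw [← lie_skew, lie_eq_chartBracket, hv]
      exact neg_zero
  rwa [hZ] at hcenter

variable [CompleteSpace 𝕜] [FiniteDimensional 𝕜 E]

theorem continuous_adjointCharacter : Continuous (adjointCharacter I : G → 𝕜) :=
  (LinearMap.continuous_of_finiteDimensional
    ((LinearMap.trace 𝕜 E).comp (ContinuousLinearMap.coeLM 𝕜))).comp continuous_Ad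

theorem eventually_Ad_ne_one (hZ : LieAlgebra.center 𝕜 (GroupLieAlgebra I G) = ⊥) :
    ∀ᶠ g in 𝓝[≠] (1 : G), Ad I g ≠ 1 := by
  obtain ⟨C, -, hC⟩ := LinearMap.exists_antilipschitzWith
    (chartBracket I G : E →ₗ[𝕜] E →L[𝕜] E)
    (LinearMap.ker_eq_bot'.2 fun _ => eq_zero_of_chartBracket_eq_zero hZ)
  have hchart := eventually_nhdsWithin_iff.1
    (hasFDerivAt_Ad_extChartAt_symm.eventually_ne ⟨C, hC⟩ (c := (1 : E →L[𝕜] E)))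
  refine eventually_nhdsWithin_iff.2 ?_
  filter_upwards [(continuousAt_extChartAt (I := I) (1 : G)).eventually hchart,
    extChartAt_source_mem_nhds (I := I) (1 : G)] with g hg hsource hne
  rw [(extChartAt I (1 : G)).left_inv hsource] at hg
  exact hg fun h => hne ((extChartAt I (1 : G)).injOn hsource (mem_extChartAt_source 1) h)

end AdjointTopology

section CompactGroup

variable {E : Type*} [NormedAddCommGroup E] [NormedSpace ℝ E] [FiniteDimensional ℝ E]
  {H : Type*} [TopologicalSpace H] {I : ModelWithCorners ℝ E H}
  {G : Type*} [TopologicalSpace G] [ChartedSpace H G] [Group G] [CompactSpace G]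
  [LieGroup I (minSmoothness ℝ 3) G] [BoundarylessManifold I G]

theorem eventually_adjointCharacter_lt
    (hZ : LieAlgebra.center ℝ (GroupLieAlgebra I G) = ⊥) :
    ∀ᶠ g in 𝓝[≠] (1 : G), adjointCharacter I g < adjointCharacter I (1 : G) := by
  have : IsTopologicalGroup G := topologicalGroup_of_lieGroup I 1
  filter_upwards [eventually_Ad_ne_one hZ] with g hg
  rw [adjointCharacter_one]
  exact trace_lt_finrank_of_ne_one continuous_Ad hg

end CompactGroup

section Flow

theorem IsPeriodicOrbit.isCompact {G : Type*} [TopologicalSpace G] {φ : ℝ → G → G}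
    {Γ : Set G} (hΓ : IsPeriodicOrbit φ Γ) (hφ : ∀ g, Continuous fun t => φ t g) :
    IsCompact Γ := by
  obtain ⟨g, ⟨T, hT, hper⟩, rfl⟩ := hΓ
  have hperiodic : Function.Periodic (fun t => φ t g) T := hper
  exact hperiodic.compact_of_continuous hT.ne' (hφ g)

theorem IsPeriodicOrbit.isInvariant {G : Type*} {φ : ℝ → G → G} {Γ : Set G}
    (hΓ : IsPeriodicOrbit φ Γ) (hφ : ∀ s t g, φ (s + t) g = φ s (φ t g)) : IsInvariant φ Γ := by
  obtain ⟨g, -, rfl⟩ := hΓ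
  rintro t _ ⟨s, rfl⟩
  exact ⟨t + s, hφ t s g⟩

variable {E : Type*} [NormedAddCommGroup E] [NormedSpace ℝ E]
  {H : Type*} [TopologicalSpace H] {I : ModelWithCorners ℝ E H}
  {G : Type*} [TopologicalSpace G] [ChartedSpace H G] {φ : ℝ → G → G}
  [IsManifold I 1 G] [BoundarylessManifold I G] [T2Space G]
  {X : (g : G) → TangentSpace I g}

theorem IsFlow.eq_of_isMIntegralCurve (hφ : IsFlow I X φ)
    (hX : ContMDiff I I.tangent 1 (fun g : G => (⟨g, X g⟩ : TangentBundle I G)))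
    {γ : ℝ → G} (hγ : IsMIntegralCurve (I := I) γ X) (t : ℝ) : γ t = φ t (γ 0) :=
  congrFun (isMIntegralCurve_Ioo_eq_of_contMDiff_boundaryless (t₀ := 0) hX hγ (hφ (γ 0)).2
    (hφ (γ 0)).1.symm) t

theorem IsFlow.add_apply (hφ : IsFlow I X φ)
    (hX : ContMDiff I I.tangent 1 (fun g : G => (⟨g, X g⟩ : TangentBundle I G)))
    (s t : ℝ) (g : G) : φ (s + t) g = φ s (φ t g) := by
  simpa using hφ.eq_of_isMIntegralCurve hX ((hφ g).2.comp_add t) s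

end Flow

section LinearVectorField

variable {E : Type*} [NormedAddCommGroup E] [NormedSpace ℝ E]
  {H : Type*} [TopologicalSpace H] {I : ModelWithCorners ℝ E H}
  {G : Type*} [TopologicalSpace G] [ChartedSpace H G] [Group G] [LieGroup I ∞ G]
  {X : (g : G) → TangentSpace I g} {φ : ℝ → G → G}

theorem IsLinearVectorField.isLieGroupAutomorphism [BoundarylessManifold I G] [T2Space G]
    (hX : IsLinearVectorField I X) (hφ : IsFlow I X φ) (t : ℝ) :
    IsLieGroupAutomorphism I (φ t) := by
  obtain ⟨φ', hφ', haut⟩ := hX.exists_flow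
  have heq : φ t = φ' t := funext fun g => by
    simpa only [(hφ g).1] using
      hφ'.eq_of_isMIntegralCurve (hX.contMDiff.of_le (by simp)) (hφ g).2 t
  exact heq ▸ haut t

end LinearVectorField

end LinearFlow

open LinearFlow Filter Topology in
theorem mainTheorem4_general
    {E : Type*} [NormedAddCommGroup E] [NormedSpace ℝ E] [FiniteDimensional ℝ E]
    {H : Type*} [TopologicalSpace H] (I : ModelWithCorners ℝ E H)
    {G : Type*} [TopologicalSpace G] [ChartedSpace H G] [Group G] [LieGroup I ∞ G]
    [BoundarylessManifold I G] [T2Space G] [CompactSpace G]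
    (hZ : LieAlgebra.center ℝ (GroupLieAlgebra I G) = ⊥)
    (X : (g : G) → TangentSpace I g) (hX : IsLinearVectorField I X)
    (φ : ℝ → G → G) (hφ : IsFlow I X φ)
    (K : Set G) (hK : IsCompact K) (hKφ : IsForwardInvariant φ K) :
    IsStableOrbit I X K := by
  intro V hV hKV
  have : IsTopologicalGroup G := topologicalGroup_of_lieGroup I ∞
  choose e he hesmooth hesymm using hX.isLieGroupAutomorphism hφ
  have hχ (t : ℝ) (x : G) : adjointCharacter I (φ t x) = adjointCharacter I x :=
    he t x ▸ adjointCharacter_map_mulEquiv ((hesmooth t).mdifferentiable (by simp))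
      ((hesymm t).mdifferentiable (by simp)) x
  have hone (U) (hU : U ∈ 𝓝 (1 : G)) : ∀ᶠ x in 𝓝 1, ∀ t : Ici (0 : ℝ), e t x ∈ U := by
    filter_upwards [eventually_forall_isPreconnected_subset continuous_adjointCharacter
      (eventually_adjointCharacter_lt hZ) hU] with x hx t
    exact he t x ▸ hx (range (φ · x)) (isPreconnected_range (hφ x).2.continuous)
      ⟨0, (hφ x).1⟩ (forall_mem_range.2 fun s => (hχ s x).ge) (mem_range_self _)
  obtain ⟨W, hW, hKW, hWV⟩ := eventually_nhdsSet_iff_exists.1 <|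
    eventually_nhdsSet_forall_map_mem (φ := fun t : Ici (0 : ℝ) => (e t).toMonoidHom) hone hK
      (fun t x hx => by simpa [he] using hKφ t.2 hx) (hV.mem_nhdsSet.2 hKV)
  have hstay (x) (hx : x ∈ W) (t : ℝ) (ht : 0 ≤ t) : φ t x ∈ V := he t x ▸ hWV x hx ⟨t, ht⟩
  refine ⟨W, hW, hKW, fun x hx => (hφ x).1 ▸ hstay x hx 0 le_rfl, fun γ hγ hγW t ht => ?_⟩
  rw [hφ.eq_of_isMIntegralCurve (hX.contMDiff.of_le (by simp)) hγ]
  exact hstay _ hγW t ht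

theorem mainTheorem4
    {E : Type*} [NormedAddCommGroup E] [NormedSpace ℝ E] [FiniteDimensional ℝ E]
    {H : Type*} [TopologicalSpace H] (I : ModelWithCorners ℝ E H)
    {G : Type*} [TopologicalSpace G] [ChartedSpace H G] [Group G] [LieGroup I ∞ G]
    [BoundarylessManifold I G] [T2Space G] [ConnectedSpace G] [CompactSpace G]
    [LieAlgebra.IsSemisimple ℝ (GroupLieAlgebra I G)]
    (X : (g : G) → TangentSpace I g) (hX : LinearFlow.IsLinearVectorField I X)
    (φ : ℝ → G → G) (hφ : LinearFlow.IsFlow I X φ)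
    (Γ : Set G) (hΓ : LinearFlow.IsPeriodicOrbit φ Γ) :
    LinearFlow.IsStableOrbit I X Γ :=
  mainTheorem4_general I (LieAlgebra.center_eq_bot ℝ _) X hX φ hφ Γ
    (hΓ.isCompact fun g => (hφ g).2.continuous)
    (hΓ.isInvariant (hφ.add_apply (hX.contMDiff.of_le (by simp)))).isForwardInvariant
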